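/- Let $k$ be a field, $n\geq 3$ an integer, $\mathcal{T}$ a $k$-linear triangulated category with shift functor $\Sigma$, $\mathcal{T}^{fd}\subseteq\mathcal{T}$ a triangulated subcategory, $M$ an object of $\mathcal{T}$ and $\mathcal{M}=\operatorname{add}(M)$ the full subcategory of direct summands of finite direct sums of copies of $M$. Assume that $(\mathcal{T},\mathcal{T}^{fd},\mathcal{M})$ is an $n$-Calabi–Yau triple, that is: (CY1) $\mathcal{T}$ is Hom-finite over $k$ and Krull–Schmidt; (CY2) there are $k$-linear isomorphisms $D\mathcal{T}(X,Y)\cong\mathcal{T}(Y,\Sigma^nX)$, where $D=\operatorname{Hom}_k(-,k)$, natural in $X\in\mathcal{T}^{fd}$ and $Y\in\mathcal{T}$; (CY3) $\mathcal{M}$ is silting, i.e. $\mathcal{T}(P,\Sigma^iP')=0$ for all $P,P'\in\mathcal{M}$ and $i>0$, and the smallest triangulated subcategory of $\mathcal{T}$ that contains $\mathcal{M}$ and is closed under direct summands is $\mathcal{T}$; moreover the pair $(\mathcal{T}^{\leq 0},\mathcal{T}^{\geq 0})=((\Sigma^{<0}\mathcal{M})^{\perp},(\Sigma^{>0}\mathcal{M})^{\perp})$,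 where $\mathcal{B}^{\perp}=\{Y\mid\mathcal{T}(B,Y)=0\text{ for all }B\in\mathcal{B}\}$, is a $t$-structure on $\mathcal{T}$, and $\mathcal{T}^{\geq 0}\subseteq\mathcal{T}^{fd}$. For $X\in\mathcal{T}$ and $m\in\mathbb{Z}$ let $f^m\colon X^{\leq m}\to X$ be the truncation of $X$ with respect to this $t$-structure, so that there is a triangle $X^{\leq m}\xrightarrow{f^m}X\to X^{\geq m+1}\to\Sigma X^{\leq m}$ with $X^{\leq m}\in\Sigma^{-m}\mathcal{T}^{\leq 0}$ and $X^{\geq m+1}\in\Sigma^{-m-1}\mathcal{T}^{\geq 0}$. Let $Q\colon\mathcal{T}\to\mathcal{T}/\mathcal{T}^{fd}$ be the Verdier quotient functor. Then, for every $X\in\mathcal{T}$ and every integer $j$, there is an isomorphism of $k$-vector spaces \[ e\colon\ \mathcal{T}/\mathcal{T}^{fd}(X,\Sigma^jM)\ \xrightarrow{\ \cong\ }\ \mathcal{T}(X^{\leq -j+n-2},\Sigma^jM), \] which is the canonical one: $Q(e(g))=g\circ Q(f^{-j+n-2})$ for all $g$. Moreover, the direct system formed by the spaces $\mathcal{T}(X^{\leq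 m},\Sigma^jM)$ as $m\to-\infty$ is stable from $m=-j+n-2$ on: for all integers $m\leq m'\leq -j+n-2$, composition with the canonical morphism $X^{\leq m}\to X^{\leq m'}$ is a bijection $\mathcal{T}(X^{\leq m'},\Sigma^jM)\to\mathcal{T}(X^{\leq m},\Sigma^jM)$. -/

import Mathlib

open CategoryTheory Limits Pretriangulated Triangulated

namespace CYTriple

universe w v u

section Additive

variable {C : Type u} [Category.{v} C] [Preadditive C] [HasFiniteBiproducts C]

/-- `add(M)`: the direct summands of finite direct sums of copies of `M`. -/
def addClosure (M : C) : ObjectProperty C :=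
  fun X ↦ ∃ r : ℕ, Nonempty (Retract X (⨁ fun _ : Fin r ↦ M))

variable (C) in
/-- Every object is a finite direct sum of objects with local endomorphism rings. -/
def IsKrullSchmidt : Prop :=
  ∀ X : C, ∃ (r : ℕ) (Y : Fin r → C),
    (∀ i, IsLocalRing (End (Y i))) ∧ Nonempty (X ≅ ⨁ Y)

end Additive

variable (k : Type w) [Field k]
  {C : Type u} [Category.{v} C] [Preadditive C] [HasZeroObject C] [HasShift C ℤ]
  [∀ m : ℤ, (shiftFunctor C m).Additive] [Pretriangulated C]

/-- A silting subcategory: there are no nonzero morphisms `P ⟶ Σ^i P'` with `P`, `P'` in it and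
`i > 0`, and the smallest triangulated subcategory closed under direct summands which contains
it is the whole category. -/
structure IsSilting (𝓜 : ObjectProperty C) : Prop where
  presilting : ∀ (P P' : C), 𝓜 P → 𝓜 P' → ∀ i : ℤ, 0 < i → ∀ f : P ⟶ P'⟦i⟧, f = 0
  thick : 𝓜.IsClassicalTriangulatedGenerator

/-- The union of the subcategories `Σ^i 𝓜` over the integers `i` in `I`. -/
def shifts (𝓜 : ObjectProperty C) (I : Set ℤ) : ObjectProperty C :=
  fun X ↦ ∃ i ∈ I, ∃ P : C, 𝓜 P ∧ Nonempty (X ≅ P⟦i⟧)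

/-- `t` is the t-structure right adjacent to `𝓜`:
`T^{≤ 0} = (Σ^{<0} 𝓜)^⊥` and `T^{≥ 0} = (Σ^{>0} 𝓜)^⊥`. -/
structure IsRightAdjacent (𝓜 : ObjectProperty C) (t : TStructure C) : Prop where
  le_zero : t.le 0 = (shifts 𝓜 (Set.Iio 0)).rightOrthogonal
  ge_zero : t.ge 0 = (shifts 𝓜 (Set.Ioi 0)).rightOrthogonal

/-- There are `k`-linear isomorphisms `D Hom(X, Y) ≅ Hom(Y, Σ^n X)`, where `D` is the `k`-dual,
natural in `X` in `Tfd` and in `Y` in the whole category. -/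
def IsRelativeCalabiYau [Linear k C] (n : ℕ) (Tfd : ObjectProperty C) : Prop :=
  ∃ φ : ∀ X Y : C, Tfd X → (Module.Dual k (X ⟶ Y) ≃ₗ[k] (Y ⟶ X⟦(n : ℤ)⟧)),
    (∀ (X X' Y : C) (hX : Tfd X) (hX' : Tfd X') (f : X ⟶ X') (ξ : Module.Dual k (X ⟶ Y)),
      φ X' Y hX' (ξ ∘ₗ Linear.leftComp k Y f) = φ X Y hX ξ ≫ f⟦(n : ℤ)⟧') ∧
    (∀ (X Y Y' : C) (hX : Tfd X) (g : Y ⟶ Y') (ξ : Module.Dual k (X ⟶ Y')),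
      φ X Y hX (ξ ∘ₗ Linear.rightComp k X g) = g ≫ φ X Y' hX ξ)

/-- `n`-Calabi–Yau triples `(C, Tfd, 𝓜)`; the integer `n` is supposed to be at least `3`. -/
structure IsCalabiYauTriple [Linear k C] (n : ℕ) (Tfd 𝓜 : ObjectProperty C) : Prop where
  three_le : 3 ≤ n
  triangulated : Tfd.IsTriangulated
  additive : 𝓜.IsClosedUnderFiniteProducts
  homFinite : ∀ X Y : C, Module.Finite k (X ⟶ Y)
  krullSchmidt : IsKrullSchmidt C
  relativeCalabiYau : IsRelativeCalabiYau k n Tfd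
  silting : IsSilting 𝓜
  exists_rightAdjacent : ∃ t : TStructure C, IsRightAdjacent 𝓜 t ∧ t.ge 0 ≤ Tfd

end CYTriple

/-! Each `X^{≤ m} ⟶ X` has cone in `T^{≥ m+1}`, hence in `Tfd` up to isomorphism, and becomes
invertible in the quotient. These maps are cofinal: `M` generates and is presilting, so an `F` in
`Tfd` has no maps to `Σ^q M` for large `q`; by duality `F` is bounded below, so `X^{≤ m} ⟶ F`
vanishes for very negative `m` (`exists_lift_natTransTruncLEOfLE_app`). Quotient morphisms are thus
computed by the system `Hom(X^{≤ m}, Σ^j M)`. The system is stable because the cone `G` of `X^{≤ m}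
⟶ X^{≤ m'}` lies in `Tfd`, up to isomorphism, and in `T^{≤ m'}`: `Hom(G, Σ^j M)` is dual to `Hom(Σ^j
M, Σ^n G)`, which vanishes when `m' < n - j`. The same vanishing for `Σ⁻¹ G` gives the bound `n - j
- 2`. -/

open scoped ZeroObject

namespace CYTriple

section Shift

variable {C : Type*} [Category* C] [Preadditive C] [HasShift C ℤ]
  [∀ m : ℤ, (shiftFunctor C m).Additive]

/-- `Hom(X⟦a⟧, Y⟦b + a⟧)` vanishes if and only if `Hom(X, Y⟦b⟧)` does. -/
lemma shift_hom_eq_zero_iff (X Y : C) (a b c : ℤ) (h : b + a = c) :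
    (∀ f : X⟦a⟧ ⟶ Y⟦c⟧, f = 0) ↔ ∀ f : X ⟶ Y⟦b⟧, f = 0 := by
  let e := (shiftFunctorAdd' C b a c h).app Y
  constructor
  · intro H f
    apply (shiftFunctor C a).map_injective
    rw [Functor.map_zero]
    have := H ((shiftFunctor C a).map f ≫ e.inv)
    rwa [← cancel_mono e.inv, zero_comp]
  · intro H f
    obtain ⟨g, hg⟩ := (shiftFunctor C a).map_surjective (f ≫ e.hom)
    rw [H g, Functor.map_zero] at hg
    rw [← cancel_mono e.hom, zero_comp, hg]

end Shift

section Add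

variable {C : Type*} [Category* C] [Preadditive C] [HasFiniteBiproducts C]

lemma addClosure_self (M : C) : addClosure M M :=
  ⟨1, ⟨⟨biproduct.ι (fun _ : Fin 1 ↦ M) 0, biproduct.π (fun _ : Fin 1 ↦ M) 0, by simp⟩⟩⟩

lemma eq_zero_of_addClosure {M P Z : C} (hP : addClosure M P) (h : ∀ f : M ⟶ Z, f = 0)
    (f : P ⟶ Z) : f = 0 := by
  obtain ⟨r, ⟨ρ⟩⟩ := hP
  have hf : ρ.r ≫ f = 0 := biproduct.hom_ext' _ _ fun i ↦ by rw [h (_ ≫ _), comp_zero]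
  rw [← Category.id_comp f, ← ρ.retract, Category.assoc, hf, comp_zero]

end Add

/-! ### Vanishing by Calabi–Yau duality -/

section CalabiYau

variable {C : Type*} [Category* C] [Preadditive C] [HasShift C ℤ]
  {k : Type*} [Field k] [Linear k C] {n : ℕ} {Tfd : ObjectProperty C}

lemma IsRelativeCalabiYau.hom_eq_zero_iff (h : IsRelativeCalabiYau k n Tfd) {X : C}
    (hX : Tfd X) (Y : C) : (∀ f : X ⟶ Y, f = 0) ↔ ∀ f : Y ⟶ X⟦(n : ℤ)⟧, f = 0 := by
  obtain ⟨φ, -, -⟩ := h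
  constructor
  · intro H f
    obtain ⟨ξ, rfl⟩ := (φ X Y hX).surjective f
    rw [show ξ = 0 from LinearMap.ext fun g ↦ by rw [H g, map_zero, map_zero], map_zero]
  · intro H f
    refine (Module.forall_dual_apply_eq_zero_iff k f).1 fun ξ ↦ ?_
    have hξ : ξ = 0 := (φ X Y hX).injective ((H _).trans (map_zero (φ X Y hX)).symm)
    rw [hξ, LinearMap.zero_apply]

end CalabiYau

variable {C : Type*} [Category* C] [Preadditive C] [HasZeroObject C] [HasShift C ℤ]
  [∀ m : ℤ, (shiftFunctor C m).Additive] [Pretriangulated C]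

/-- Precomposition with the first morphism of a distinguished triangle is bijective on morphisms
to `Z` as soon as there are no nonzero morphisms from the cone and its desuspension to `Z`. -/
lemma bijective_precomp_of_distTriang (T : Triangle C) (hT : T ∈ distTriang C) (Z : C)
    (h₀ : ∀ f : T.obj₃ ⟶ Z, f = 0) (h₁ : ∀ f : T.obj₃⟦(-1 : ℤ)⟧ ⟶ Z, f = 0) :
    Function.Bijective (fun g : T.obj₂ ⟶ Z ↦ T.mor₁ ≫ g) := by
  constructor
  · intro g₁ g₂ hg
    obtain ⟨u, hu⟩ := Triangle.yoneda_exact₂ T hT (g₁ - g₂)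
      (by rw [Preadditive.comp_sub]; exact sub_eq_zero.2 hg)
    rwa [h₀ u, comp_zero, sub_eq_zero] at hu
  · intro g
    obtain ⟨u, hu⟩ := Triangle.yoneda_exact₂ _ (inv_rot_of_distTriang T hT) g (h₁ _)
    exact ⟨u, hu.symm⟩

/-- The objects without nonzero morphisms to `M⟦q⟧` for `q` large enough. -/
def eventuallyLeftOrthogonal (M : C) : ObjectProperty C :=
  fun X ↦ ∃ N : ℤ, ∀ q : ℤ, N ≤ q → ∀ f : X ⟶ M⟦q⟧, f = 0

instance (M : C) : (eventuallyLeftOrthogonal M).IsStableUnderRetracts where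
  of_retract := by
    rintro X Y ρ ⟨N, hN⟩
    refine ⟨N, fun q hq f ↦ ?_⟩
    rw [← Category.id_comp f, ← ρ.retract, Category.assoc, hN q hq (ρ.r ≫ f), comp_zero]

instance (M : C) : (eventuallyLeftOrthogonal M).IsTriangulated where
  exists_zero := ⟨0, isZero_zero C, 0, fun _ _ _ ↦ (isZero_zero C).eq_of_src _ _⟩
  isStableUnderShiftBy a :=
    { le_shift := by
        rintro X ⟨N, hN⟩
        exact ⟨N + a, fun q hq ↦ (shift_hom_eq_zero_iff X M a (q - a) q (by lia)).2
          (hN (q - a) (by lia))⟩ }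
  toIsTriangulatedClosed₂ := .mk' (by
    rintro T hT ⟨N₁, h₁⟩ ⟨N₃, h₃⟩
    refine ⟨max N₁ N₃, fun q hq f ↦ ?_⟩
    obtain ⟨g, rfl⟩ := Triangle.yoneda_exact₂ T hT f (h₁ q (le_trans (le_max_left _ _) hq) _)
    rw [h₃ q (le_trans (le_max_right _ _) hq) g, comp_zero])

/-- The objects with this property form a thick subcategory, which contains `𝓜` by the presilting
condition (bound `1`); `𝓜` generates. -/
lemma IsSilting.eventuallyLeftOrthogonal {𝓜 : ObjectProperty C} (h𝓜 : IsSilting 𝓜) {M : C}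
    (hM : 𝓜 M) (X : C) : eventuallyLeftOrthogonal M X := by
  have h : 𝓜.triangEnvelope ≤ CYTriple.eventuallyLeftOrthogonal M :=
    (ObjectProperty.triangEnvelope_le_iff 𝓜).2
      fun P hP ↦ ⟨1, fun q hq ↦ h𝓜.presilting P M hP hM q (by lia)⟩
  exact h X (by rw [h𝓜.thick]; trivial)

/-! ### Truncations for the silting t-structure -/

section TStructure

variable {M : C} {t : TStructure C}

/-- There are no nonzero morphisms from `M⟦p⟧` to `G⟦q⟧` for `G` in `T^{≤ a}` and `a < q - p`. -/
lemma IsRightAdjacent.eq_zero_of_isLE (ht : IsRightAdjacent (addClosure M) t) (G : C) (a p q : ℤ)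
    [t.IsLE G a] (h : a < q - p) (f : M⟦p⟧ ⟶ G⟦q⟧) : f = 0 := by
  revert f
  -- Shifting to `G⟦a⟧`, which lies in `T^{≤ 0}`, leaves `M` with the negative shift `a - (q - p)`.
  rw [shift_hom_eq_zero_iff M G p (q - p) q (by lia),
    ← shift_hom_eq_zero_iff M G (a - (q - p)) (q - p) a (by lia)]
  intro f
  have hG := (t.isLE_shift G a a 0).le
  rw [ht.le_zero] at hG
  exact hG f ⟨_, by simp; lia, M, addClosure_self M, ⟨Iso.refl _⟩⟩

lemma IsRightAdjacent.isGE_of_forall_eq_zero (ht : IsRightAdjacent (addClosure M) t) (F : C)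
    (c : ℤ) (h : ∀ b < c, ∀ f : M ⟶ F⟦b⟧, f = 0) : t.IsGE F c := by
  have : t.IsGE (F⟦c⟧) 0 := ⟨by
    rw [ht.ge_zero]
    rintro X f ⟨i, hi, P, hP, ⟨e⟩⟩
    rw [← cancel_epi e.inv, comp_zero]
    exact (shift_hom_eq_zero_iff P F i (c - i) c (by lia)).2
      (eq_zero_of_addClosure hP (h (c - i) (by simp at hi; lia))) _⟩
  exact t.isGE_of_shift F c c 0

/-- A triangulated subcategory which contains `T^{≥ 0}` contains every `T^{≥ a}`. -/
lemma isoClosure_of_isGE {Tfd : ObjectProperty C} [Tfd.IsStableUnderShift ℤ]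
    (h : t.ge 0 ≤ Tfd) (F : C) (a : ℤ) [t.IsGE F a] : Tfd.isoClosure F :=
  -- `Tfd` need not be closed under isomorphisms, and shifting back recovers `F` only up to
  -- isomorphism.
  ⟨F⟦a⟧⟦-a⟧, Tfd.le_shift (-a) _ (h _ (t.isGE_shift F a a 0).ge),
    ⟨(shiftEquiv C a).unitIso.app F⟩⟩

/-- The canonical morphism `X^{≤ m} ⟶ X^{≤ m'}` has its cone in `T^{≥ m + 1}` and in
`T^{≤ m'}`. -/
lemma exists_distTriang_natTransTruncLEOfLE [IsTriangulated C] (t : TStructure C) (X : C)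
    (m m' : ℤ) (hm : m ≤ m') :
    ∃ (G : C) (g : (t.truncLE m').obj X ⟶ G) (h : G ⟶ ((t.truncLE m).obj X)⟦(1 : ℤ)⟧),
      Triangle.mk ((t.natTransTruncLEOfLE m m' hm).app X) g h ∈ distTriang C ∧
        t.IsGE G (m + 1) ∧ t.IsLE G m' := by
  obtain ⟨G, g, h, hT⟩ := distinguished_cocone_triangle ((t.natTransTruncLEOfLE m m' hm).app X)
  refine ⟨G, g, h, hT, ?_, ?_⟩
  -- The octahedron makes `G` an extension of `X^{≥ m+1}` by `Σ⁻¹ X^{≥ m'+1}`.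
  · have H := someOctahedron (t.natTransTruncLEOfLE_ι_app m m' hm X) hT
      (t.triangleLEGE_distinguished m' (m' + 1) rfl X)
      (t.triangleLEGE_distinguished m (m + 1) rfl X)
    refine t.isGE₂ _ (inv_rot_of_distTriang _ H.mem) (m + 1) ?_ ?_
    · have : t.IsGE (((t.truncGE (m' + 1)).obj X)⟦(-1 : ℤ)⟧) (m' + 2) :=
        t.isGE_shift _ (m' + 1) (-1) (m' + 2)
      exact t.isGE_of_ge (((t.truncGE (m' + 1)).obj X)⟦(-1 : ℤ)⟧) _ (m' + 2)
    · exact inferInstanceAs (t.IsGE ((t.truncGE (m + 1)).obj X) (m + 1))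
  · refine t.isLE₂ _ (rot_of_distTriang _ hT) m' ?_ ?_
    · exact inferInstanceAs (t.IsLE ((t.truncLE m').obj X) m')
    · have : t.IsLE (((t.truncLE m).obj X)⟦(1 : ℤ)⟧) (m - 1) := t.isLE_shift _ m 1 (m - 1)
      exact t.isLE_of_le (((t.truncLE m).obj X)⟦(1 : ℤ)⟧) (m - 1) m'

end TStructure

/-! ### Cofinality, stabilization and the quotient -/

namespace IsCalabiYauTriple

variable {k : Type*} [Field k] [Linear k C] {n : ℕ} {Tfd : ObjectProperty C} {M : C}
  {t : TStructure C}

lemma ge_zero_le (hT : IsCalabiYauTriple k n Tfd (addClosure M))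
    (ht : IsRightAdjacent (addClosure M) t) : t.ge 0 ≤ Tfd := by
  obtain ⟨t', ht', h⟩ := hT.exists_rightAdjacent
  -- Adjacency to `M` determines `T^{≥ 0}`, so `t'` and `t` share it.
  rwa [ht.ge_zero, ← ht'.ge_zero]

/-- The objects of `Tfd` are bounded below. -/
lemma exists_isGE (hT : IsCalabiYauTriple k n Tfd (addClosure M))
    (ht : IsRightAdjacent (addClosure M) t) {F : C} (hF : Tfd F) : ∃ c : ℤ, t.IsGE F c := by
  obtain ⟨N, hN⟩ := hT.silting.eventuallyLeftOrthogonal (addClosure_self M) F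
  refine ⟨n - N, ht.isGE_of_forall_eq_zero F _ fun b hb ↦ ?_⟩
  rw [← shift_hom_eq_zero_iff M F (n - b) b n (by lia),
    ← hT.relativeCalabiYau.hom_eq_zero_iff hF]
  exact hN _ (by lia)

/-- There are no nonzero morphisms from `G` to `M⟦j⟧` if `G` belongs to `Tfd` and to `T^{≤ a}`
with `a < n - j`. -/
lemma eq_zero_of_isLE (hT : IsCalabiYauTriple k n Tfd (addClosure M))
    (ht : IsRightAdjacent (addClosure M) t) {G : C} (hG : Tfd.isoClosure G) (a j : ℤ)
    [t.IsLE G a] (h : a < n - j) (f : G ⟶ M⟦j⟧) : f = 0 := by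
  obtain ⟨G', hG', ⟨e⟩⟩ := hG
  have := t.isLE_of_iso e a
  rw [← cancel_epi e.inv, comp_zero]
  exact (hT.relativeCalabiYau.hom_eq_zero_iff hG' _).2 (ht.eq_zero_of_isLE G' a j n h) _

/-- The truncations of `X` are cofinal among the morphisms to a truncation of `X` with cone
in `Tfd`. -/
lemma exists_lift_natTransTruncLEOfLE_app (hT : IsCalabiYauTriple k n Tfd (addClosure M))
    (ht : IsRightAdjacent (addClosure M) t) (X : C) (N : ℤ) {Y : C}
    (s : Y ⟶ (t.truncLE N).obj X) (hs : Tfd.trW s) :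
    ∃ (m : ℤ) (hm : m ≤ N) (u : (t.truncLE m).obj X ⟶ Y),
      u ≫ s = (t.natTransTruncLEOfLE m N hm).app X := by
  obtain ⟨F, g, h, hF, hF'⟩ := hs
  obtain ⟨c, _⟩ := hT.exists_isGE ht hF'
  -- Below `c` there are no maps from the truncation to the cone `F`, so the transition map lifts
  -- through `s`.
  have hm : min N (c - 1) ≤ N := min_le_left _ _
  obtain ⟨u, hu⟩ := Triangle.coyoneda_exact₂ _ hF ((t.natTransTruncLEOfLE _ N hm).app X)
    (t.zero_of_isLE_of_isGE _ (min N (c - 1)) c (by lia) inferInstance ‹_›)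
  exact ⟨_, hm, u, hu.symm⟩

variable [Tfd.IsTriangulated]

lemma trW_truncLEι_app (hT : IsCalabiYauTriple k n Tfd (addClosure M))
    (ht : IsRightAdjacent (addClosure M) t) (X : C) (m : ℤ) :
    Tfd.trW ((t.truncLEι m).app X) := by
  rw [← ObjectProperty.trW_isoClosure]
  exact ⟨_, _, _, t.triangleLEGE_distinguished m (m + 1) rfl X,
    isoClosure_of_isGE (hT.ge_zero_le ht) ((t.truncGE (m + 1)).obj X) (m + 1)⟩

variable [IsTriangulated C]

lemma trW_natTransTruncLEOfLE_app (hT : IsCalabiYauTriple k n Tfd (addClosure M))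
    (ht : IsRightAdjacent (addClosure M) t) (X : C) (m m' : ℤ) (hm : m ≤ m') :
    Tfd.trW ((t.natTransTruncLEOfLE m m' hm).app X) := by
  obtain ⟨G, g, h, hG, _, _⟩ := exists_distTriang_natTransTruncLEOfLE t X m m' hm
  rw [← ObjectProperty.trW_isoClosure]
  exact ⟨G, g, h, hG, isoClosure_of_isGE (hT.ge_zero_le ht) G (m + 1)⟩

lemma bijective_natTransTruncLEOfLE_app_comp (hT : IsCalabiYauTriple k n Tfd (addClosure M))
    (ht : IsRightAdjacent (addClosure M) t) (X : C) (j m m' : ℤ) (hm : m ≤ m')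
    (hm' : m' ≤ -j + n - 2) :
    Function.Bijective (fun g : (t.truncLE m').obj X ⟶ M⟦j⟧ ↦
      (t.natTransTruncLEOfLE m m' hm).app X ≫ g) := by
  obtain ⟨G, g, h, hG, _, _⟩ := exists_distTriang_natTransTruncLEOfLE t X m m' hm
  have hG' : Tfd.isoClosure G := isoClosure_of_isGE (hT.ge_zero_le ht) G (m + 1)
  have : t.IsLE (G⟦(-1 : ℤ)⟧) (m' + 1) := t.isLE_shift G m' (-1) (m' + 1)
  exact bijective_precomp_of_distTriang _ hG _
    (hT.eq_zero_of_isLE ht hG' m' j (by lia))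
    -- Desuspension raises the degree bound to `m' + 1`; only here is `-j + n - 2` needed rather
    -- than `-j + n - 1`.
    (hT.eq_zero_of_isLE ht (Tfd.isoClosure.le_shift (-1) _ hG') (m' + 1) j (by lia))

/-- The quotient functor `C ⥤ C / Tfd` is bijective on morphisms `X^{≤ N} ⟶ M⟦j⟧` for
`N ≤ n - j - 2`. -/
lemma bijective_map_truncLE (hT : IsCalabiYauTriple k n Tfd (addClosure M))
    (ht : IsRightAdjacent (addClosure M) t) {D : Type*} [Category* D] (L : C ⥤ D)
    [L.IsLocalization Tfd.trW] (X : C) (j N : ℤ) (hN : N ≤ -j + n - 2) :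
    Function.Bijective (L.map : ((t.truncLE N).obj X ⟶ M⟦j⟧) → _) := by
  constructor
  · intro b₁ b₂ hb
    rw [MorphismProperty.map_eq_iff_precomp L Tfd.trW] at hb
    obtain ⟨Y, s, hs, h⟩ := hb
    obtain ⟨m, hm, u, hu⟩ := hT.exists_lift_natTransTruncLEOfLE_app ht X N s hs
    apply (hT.bijective_natTransTruncLEOfLE_app_comp ht X j m N hm hN).1
    simp only [← hu, Category.assoc, h]
  · intro g
    obtain ⟨φ, rfl⟩ := Localization.exists_rightFraction L Tfd.trW g
    obtain ⟨m, hm, u, hu⟩ := hT.exists_lift_natTransTruncLEOfLE_app ht X N φ.s φ.hs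
    -- The fraction is refined to one with denominator `X^{≤ m} ⟶ X^{≤ N}`; by stability its
    -- numerator extends to `X^{≤ N}`.
    obtain ⟨b, hb⟩ := (hT.bijective_natTransTruncLEOfLE_app_comp ht X j m N hm hN).2 (u ≫ φ.f)
    have := Localization.inverts L Tfd.trW _ (hT.trW_natTransTruncLEOfLE_app ht X m N hm)
    dsimp only at hb
    refine ⟨b, ?_⟩
    rw [← cancel_epi (L.map ((t.natTransTruncLEOfLE m N hm).app X)), ← L.map_comp, hb, ← hu,
      L.map_comp, L.map_comp, Category.assoc, MorphismProperty.RightFraction.map_s_comp_map]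

end IsCalabiYauTriple

end CYTriple

/-- The Verdier quotient `C / Tfd` is the localization of `C` at the class `Tfd.trW` of morphisms
with cone in `Tfd`, with its quotient functor `Tfd.trW.Q` and the induced `k`-linear structure;
`(t.truncLE m).obj X` is `X^{≤ m}`, and `M⟦j⟧` is `Σ^j M`. -/
theorem mainTheorem5 {k : Type*} [Field k] {C : Type*} [Category* C] [Preadditive C]
    [HasZeroObject C] [HasShift C ℤ] [∀ m : ℤ, (shiftFunctor C m).Additive] [Pretriangulated C]
    [IsTriangulated C] [Linear k C] [∀ m : ℤ, (shiftFunctor C m).Linear k]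
    (n : ℕ) (Tfd : ObjectProperty C) [Tfd.IsTriangulated] (M : C)
    (hT : CYTriple.IsCalabiYauTriple k n Tfd (CYTriple.addClosure M))
    (t : TStructure C) (ht : CYTriple.IsRightAdjacent (CYTriple.addClosure M) t)
    (X : C) (j : ℤ) :
    (∃ e : (Tfd.trW.Q.obj X ⟶ Tfd.trW.Q.obj (M⟦j⟧)) ≃ₗ[k]
        ((t.truncLE (-j + n - 2)).obj X ⟶ M⟦j⟧),
      ∀ g, Tfd.trW.Q.map (e g) = Tfd.trW.Q.map ((t.truncLEι (-j + n - 2)).app X) ≫ g) ∧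
    ∀ (m m' : ℤ) (hm : m ≤ m'), m' ≤ -j + n - 2 →
      Function.Bijective (fun g : (t.truncLE m').obj X ⟶ M⟦j⟧ ↦
        (t.natTransTruncLEOfLE m m' hm).app X ≫ g) := by
  refine ⟨?_, fun m m' hm hm' ↦ hT.bijective_natTransTruncLEOfLE_app_comp ht X j m m' hm hm'⟩
  have := Localization.inverts Tfd.trW.Q Tfd.trW _ (hT.trW_truncLEι_app ht X (-j + n - 2))
  let e₁ : ((t.truncLE (-j + n - 2)).obj X ⟶ M⟦j⟧) ≃ₗ[k] _ :=
    LinearEquiv.ofBijective (Tfd.trW.Q.mapLinearMap k)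
      (hT.bijective_map_truncLE ht Tfd.trW.Q X j _ le_rfl)
  let e₂ := Linear.homCongr k (asIso (Tfd.trW.Q.map ((t.truncLEι (-j + n - 2)).app X))).symm
    (Iso.refl (Tfd.trW.Q.obj (M⟦j⟧)))
  refine ⟨e₂ ≪≫ₗ e₁.symm, fun g ↦ (e₁.apply_symm_apply (e₂ g)).trans ?_⟩
  exact (Linear.homCongr_apply k _ _ g).trans (Category.comp_id _)
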